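/- All manifolds are smooth, Hausdorff, second countable and without boundary. Let $M$ be a manifold of dimension $2d+1$. A \emph{stable Hamiltonian (shs) structure} on $M$ is a pair $(\Omega,\alpha)$ of a closed 2-form $\Omega$ with $\Omega^d$ nowhere vanishing and a 1-form $\alpha$ such that $\alpha\wedge\Omega^d$ is nowhere vanishing and $\ker\Omega\subseteq\ker d\alpha$. Its Reeb vector field $E$ is given by $i_E\Omega=0$, $\alpha(E)=1$. If $\alpha$ is a contact form, i.e. $\alpha\wedge(d\alpha)^d$ is nowhere vanishing, then $(d\alpha,\alpha)$ is such a structure. An \emph{almost contact metric structure associated with $(\Omega,\alpha)$} consists of $\alpha$, $E$, a field $\Theta$ of endomorphisms of $TM$ and a Riemannian metric $g$ with $\Theta^2=-I+\alpha\otimes E$, $\Theta E=0$, $\alpha\circ\Theta=0$, $\alpha=g(\cdot,E)$ and $g=\Omega(\cdot,\Theta\,\cdot)+\alpha\otimes\alpha$. Affine connections $\nabla,\nabla^*$ are \emph{dual} with respect to $g$ if $X\,g(Y,Z)=g(\nabla_XY,Z)+g(Y,\nabla^*_XZ)$ for all vector fields $X,Y,Z$. A dual pair $(\nabla,\nabla^*)$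 is a \emph{SMAT} pair if $\nabla$ is torsion-free, and it is \emph{statistical} if both $\nabla$ and $\nabla^*$ are torsion-free. A \emph{SMAT shs connection pair} on $(M,\Omega,\alpha,g)$, where $g$ belongs to an almost contact metric structure associated with $(\Omega,\alpha)$, is a SMAT pair $(\nabla,\nabla^*)$ such that $\nabla E=0$ and $\nabla\Omega=0$, or $\nabla^*\alpha=0$ and $\nabla\Omega=0$. Then: (1) If $d\ge 1$, $M$ is non-empty and $\alpha$ is a contact form on $M$, then, for every almost contact metric structure associated with $(d\alpha,\alpha)$, no SMAT shs connection pair on $(M,d\alpha,\alpha,g)$ is statistical. (2) If $M$ is compact and connected with finite fundamental group and $(\Omega,\alpha)$ is an shs structure on $M$, then, for every almost contact metric structure associated with $(\Omega,\alpha)$, no SMAT shs connection pair on $(M,\Omega,\alpha,g)$ is statistical. -/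

import Mathlib

open scoped Manifold ContDiff Bundle

noncomputable section

namespace ShsGeometry

/-! ### Differential forms on a smooth manifold (without boundary) of dimension `n` -/

section Forms

variable {n k l : ℕ} {M : Type*} [TopologicalSpace M] [ChartedSpace (EuclideanSpace ℝ (Fin n)) M]

/-- A (not necessarily smooth) differential `k`-form: an alternating `k`-linear form on each
tangent space. -/
abbrev DiffForm (n k : ℕ) (M : Type*) [TopologicalSpace M]
    [ChartedSpace (EuclideanSpace ℝ (Fin n)) M] : Type _ :=
  (x : M) → TangentSpace (𝓡 n) x [⋀^Fin k]→L[ℝ] ℝ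

/-- The coordinate expression of a form in the chart at `x₀`: the pullback of the form by the
inverse of the chart, a form on `ℝⁿ` (relevant only on the open target of the chart). -/
def DiffForm.inChart (β : DiffForm n k M) (x₀ : M) (y : EuclideanSpace ℝ (Fin n)) :
    EuclideanSpace ℝ (Fin n) [⋀^Fin k]→L[ℝ] ℝ :=
  (β ((extChartAt (𝓡 n) x₀).symm y)).compContinuousLinearMap
    (mfderiv (𝓡 n) (𝓡 n) (extChartAt (𝓡 n) x₀).symm y)

/-- A form is smooth if its coordinate expressions are smooth. -/
def DiffForm.IsSmooth (β : DiffForm n k M) : Prop :=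
  ∀ x₀ : M, ContDiffOn ℝ ∞ (β.inChart x₀) (extChartAt (𝓡 n) x₀).target

/-- The exterior derivative: at `x`, it is computed in the chart at `x` and pulled back to `T_x M`
by the differential of the chart. -/
def DiffForm.d (β : DiffForm n k M) : DiffForm n (k + 1) M := fun x ↦
  (extDeriv (β.inChart x) (extChartAt (𝓡 n) x x)).compContinuousLinearMap
    (mfderiv (𝓡 n) (𝓡 n) (extChartAt (𝓡 n) x) x)

/-- The exterior product of two alternating forms on a vector space. -/
def wedge {V : Type*} [AddCommGroup V] [Module ℝ V]
    (a : V [⋀^Fin k]→ₗ[ℝ] ℝ) (b : V [⋀^Fin l]→ₗ[ℝ] ℝ) : V [⋀^Fin (k + l)]→ₗ[ℝ] ℝ :=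
  ((LinearMap.mul' ℝ ℝ).compAlternatingMap (a.domCoprod b)).domDomCongr finSumFinEquiv

/-- The `m`-th exterior power `b ∧ ⋯ ∧ b` of an alternating 2-form on a vector space. -/
def wedgePow {V : Type*} [AddCommGroup V] [Module ℝ V] (b : V [⋀^Fin 2]→ₗ[ℝ] ℝ) :
    (m : ℕ) → V [⋀^Fin (2 * m)]→ₗ[ℝ] ℝ
  | 0 => AlternatingMap.constOfIsEmpty ℝ V (Fin 0) 1
  | m + 1 => wedge (wedgePow b m) b

end Forms

/-! ### Stable Hamiltonian structures and contact forms in dimension `2 d + 1` -/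

section Shs

variable {d : ℕ} {M : Type*} [TopologicalSpace M]
  [ChartedSpace (EuclideanSpace ℝ (Fin (2 * d + 1))) M]

/-- A Hamiltonian structure: a closed 2-form `Ω` with `Ω^d` nowhere vanishing. -/
structure IsHamiltonian (Ω : DiffForm (2 * d + 1) 2 M) : Prop where
  smooth : Ω.IsSmooth
  closed : Ω.d = 0
  pow_ne_zero : ∀ x, wedgePow (Ω x).toAlternatingMap d ≠ 0

/-- A stable Hamiltonian structure `(Ω, α)`: `Ω` is Hamiltonian and the 1-form `α` is stabilizing,
i.e. `α ∧ Ω^d` vanishes nowhere and `ker Ω ⊆ ker dα`. -/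
structure IsStableHamiltonian (Ω : DiffForm (2 * d + 1) 2 M) (α : DiffForm (2 * d + 1) 1 M) :
    Prop where
  hamiltonian : IsHamiltonian Ω
  smooth : α.IsSmooth
  volume_ne_zero : ∀ x, wedge (α x).toAlternatingMap (wedgePow (Ω x).toAlternatingMap d) ≠ 0
  ker_le : ∀ (x : M) (v : TangentSpace (𝓡 (2 * d + 1)) x),
    (∀ w, Ω x ![v, w] = 0) → ∀ w, α.d x ![v, w] = 0

/-- A contact form: a 1-form `α` with `α ∧ (dα)^d` nowhere vanishing. -/
structure IsContactForm (α : DiffForm (2 * d + 1) 1 M) : Prop where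
  smooth : α.IsSmooth
  volume_ne_zero : ∀ x, wedge (α x).toAlternatingMap (wedgePow (α.d x).toAlternatingMap d) ≠ 0

end Shs

/-! ### Metrics and connections -/

section Connections

variable {n : ℕ} {M : Type*} [TopologicalSpace M] [ChartedSpace (EuclideanSpace ℝ (Fin n)) M]
  [IsManifold (𝓡 n) ∞ M]

/-- A vector field is smooth. -/
def IsSmoothField (X : (x : M) → TangentSpace (𝓡 n) x) : Prop :=
  ContMDiff (𝓡 n) (𝓡 n).tangent ∞
    (fun x ↦ (⟨x, X x⟩ : TangentBundle (𝓡 n) M))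

/-- A vector field is differentiable at `x`. -/
def DifferentiableFieldAt (X : (x : M) → TangentSpace (𝓡 n) x) (x : M) : Prop :=
  MDifferentiableAt (𝓡 n) (𝓡 n).tangent
    (fun x ↦ (⟨x, X x⟩ : TangentBundle (𝓡 n) M)) x

/-- A smooth Riemannian metric on `M`. -/
abbrev Metric (n : ℕ) (M : Type*) [TopologicalSpace M]
    [ChartedSpace (EuclideanSpace ℝ (Fin n)) M] [IsManifold (𝓡 n) ∞ M] : Type _ :=
  Bundle.ContMDiffRiemannianMetric (𝓡 n) ∞ (EuclideanSpace ℝ (Fin n))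
    (fun x : M ↦ TangentSpace (𝓡 n) x)

/-- An affine connection on `M`. Caution on the argument order: `cov Y x v` is `∇_v Y`. -/
abbrev Connection (n : ℕ) (M : Type*) [TopologicalSpace M]
    [ChartedSpace (EuclideanSpace ℝ (Fin n)) M] [IsManifold (𝓡 n) ∞ M] : Type _ :=
  CovariantDerivative (𝓡 n) (EuclideanSpace ℝ (Fin n)) (fun x : M ↦ TangentSpace (𝓡 n) x)

/-- `E` is the Reeb vector field of `(Ω, α)`: `i_E Ω = 0` and `α(E) = 1`. -/
structure IsReebField (Ω : DiffForm n 2 M) (α : DiffForm n 1 M)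
    (E : (x : M) → TangentSpace (𝓡 n) x) : Prop where
  smooth : IsSmoothField E
  contract : ∀ (x : M) (w : TangentSpace (𝓡 n) x), Ω x ![E x, w] = 0
  apply_eq_one : ∀ x, α x ![E x] = 1

/-- `(Θ, E, α, g)` is an almost contact metric structure associated with `(Ω, α)`. -/
structure IsAlmostContactMetric (Ω : DiffForm n 2 M) (α : DiffForm n 1 M)
    (E : (x : M) → TangentSpace (𝓡 n) x)
    (Θ : (x : M) → TangentSpace (𝓡 n) x →L[ℝ] TangentSpace (𝓡 n) x) (g : Metric n M) : Prop where
  reeb : IsReebField Ω α E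
  smooth : ContMDiff (𝓡 n)
    ((𝓡 n).prod 𝓘(ℝ, EuclideanSpace ℝ (Fin n) →L[ℝ] EuclideanSpace ℝ (Fin n))) ∞
    (fun x ↦ Bundle.TotalSpace.mk' (EuclideanSpace ℝ (Fin n) →L[ℝ] EuclideanSpace ℝ (Fin n))
      (E := fun x : M ↦ TangentSpace (𝓡 n) x →L[ℝ] TangentSpace (𝓡 n) x) x (Θ x))
  sq : ∀ (x : M) (v : TangentSpace (𝓡 n) x), Θ x (Θ x v) = -v + α x ![v] • E x
  map_reeb : ∀ x, Θ x (E x) = 0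
  comp_eq_zero : ∀ (x : M) (v : TangentSpace (𝓡 n) x), α x ![Θ x v] = 0
  alpha_eq : ∀ (x : M) (v : TangentSpace (𝓡 n) x), α x ![v] = g.inner x v (E x)
  metric_eq : ∀ (x : M) (v w : TangentSpace (𝓡 n) x),
    g.inner x v w = Ω x ![v, Θ x w] + α x ![v] * α x ![w]

/-- `∇` and `∇'` are dual with respect to `g`:
`X g(Y, Z) = g(∇_X Y, Z) + g(Y, ∇'_X Z)`. -/
def IsDual (g : Metric n M) (cov cov' : Connection n M) : Prop :=
  ∀ (x : M) (v : TangentSpace (𝓡 n) x) (Y Z : (x : M) → TangentSpace (𝓡 n) x),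
    DifferentiableFieldAt Y x → DifferentiableFieldAt Z x →
    mvfderiv (𝓡 n) (fun p ↦ g.inner p (Y p) (Z p)) x v =
      g.inner x (cov Y x v) (Z x) + g.inner x (Y x) (cov' Z x v)

/-- `(g, ∇, ∇')` is a dualistic structure: smooth connections that are dual with respect to `g`. -/
structure IsDualistic (g : Metric n M) (cov cov' : Connection n M) : Prop where
  smooth : cov.ContMDiffCovariantDerivative ∞
  smooth' : cov'.ContMDiffCovariantDerivative ∞
  dual : IsDual g cov cov'

/-- `(M, g, ∇, ∇')` is a statistical manifold admitting torsion (SMAT). -/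
structure IsSmat (g : Metric n M) (cov cov' : Connection n M) : Prop where
  dualistic : IsDualistic g cov cov'
  torsion_eq_zero : cov.torsion = 0

/-- `(M, g, ∇, ∇')` is a statistical manifold. -/
structure IsStatistical (g : Metric n M) (cov cov' : Connection n M) : Prop where
  dualistic : IsDualistic g cov cov'
  torsion_eq_zero : cov.torsion = 0
  torsion_eq_zero' : cov'.torsion = 0

/-- `∇ Ω = 0` for a 2-form. -/
def IsParallelTwoForm (cov : Connection n M) (Ω : DiffForm n 2 M) : Prop :=
  ∀ (x : M) (v : TangentSpace (𝓡 n) x) (Y Z : (x : M) → TangentSpace (𝓡 n) x),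
    DifferentiableFieldAt Y x → DifferentiableFieldAt Z x →
    mvfderiv (𝓡 n) (fun p ↦ Ω p ![Y p, Z p]) x v
      - Ω x ![cov Y x v, Z x] - Ω x ![Y x, cov Z x v] = 0

/-- `∇ α = 0` for a 1-form. -/
def IsParallelOneForm (cov : Connection n M) (α : DiffForm n 1 M) : Prop :=
  ∀ (x : M) (v : TangentSpace (𝓡 n) x) (Y : (x : M) → TangentSpace (𝓡 n) x),
    DifferentiableFieldAt Y x →
    mvfderiv (𝓡 n) (fun p ↦ α p ![Y p]) x v - α x ![cov Y x v] = 0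

/-- `∇ X = 0` for a vector field. -/
def IsParallelField (cov : Connection n M) (X : (x : M) → TangentSpace (𝓡 n) x) : Prop :=
  ∀ (x : M) (v : TangentSpace (𝓡 n) x), cov X x v = 0

/-- `(∇, ∇')` is a pair of SMAT shs connections on `(M, Ω, α, g)`, where `E` is the Reeb vector
field. -/
structure IsSmatShsPair (Ω : DiffForm n 2 M) (α : DiffForm n 1 M)
    (E : (x : M) → TangentSpace (𝓡 n) x) (g : Metric n M) (cov cov' : Connection n M) : Prop where
  smat : IsSmat g cov cov'
  adapted : (IsParallelField cov E ∧ IsParallelTwoForm cov Ω) ∨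
    (IsParallelOneForm cov' α ∧ IsParallelTwoForm cov Ω)

end Connections

end ShsGeometry

end

/-! Both alternatives in the definition of a SMAT shs pair give `∇*α = 0`: since `α = g(·, E)`,
duality turns `∇E = 0` into it. If `∇*` is torsion-free, a `∇*`-parallel 1-form is closed
(`IsParallelOneForm.fderiv_inChart_symm`), so a statistical pair forces `dα = 0`.

For a contact form with `d ≥ 1` this contradicts `α ∧ (dα)^d ≠ 0`. In the compact case, finiteness
of the fundamental group makes the closed form `α` exact; a primitive has a maximum, where `α`
vanishes, against `α(E) = 1`.

Exactness is obtained without integrating over loops. The germs of local primitives form a covering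
of `M`. A path component of it has finite non-empty fibres, so over each point it contains a germ of
largest value, and these values make up a global primitive
(`exists_global_of_locally_constant_differences`). -/

namespace ShsGeometry

open VectorField Topology Set

variable {n : ℕ} {M : Type*} [TopologicalSpace M] [ChartedSpace (EuclideanSpace ℝ (Fin n)) M]
  [IsManifold (𝓡 n) ∞ M]

/-! ### Coordinate fields and 1-forms in charts -/

/-- The vector field with constant components `v` in the chart at `x₀`. -/
noncomputable def coordField (x₀ : M) (v : EuclideanSpace ℝ (Fin n)) : (x : M) → TangentSpace (𝓡 n) x :=
  mpullback (𝓡 n) 𝓘(ℝ, EuclideanSpace ℝ (Fin n)) (extChartAt (𝓡 n) x₀) fun _ ↦ v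

theorem mdifferentiableAt_const_field (v y : EuclideanSpace ℝ (Fin n)) :
    MDifferentiableAt 𝓘(ℝ, EuclideanSpace ℝ (Fin n)) (𝓘(ℝ, EuclideanSpace ℝ (Fin n))).tangent
      (fun y ↦ (⟨y, v⟩ : TangentBundle 𝓘(ℝ, EuclideanSpace ℝ (Fin n))
        (EuclideanSpace ℝ (Fin n)))) y := by
  exact (contMDiffAt_vectorSpace_iff_contDiffAt (n := 1)
    (V := fun _ : EuclideanSpace ℝ (Fin n) ↦ v)).2 contDiffAt_const |>.mdifferentiableAt one_ne_zero

theorem differentiableFieldAt_coordField {x₀ x : M} (hx : x ∈ (extChartAt (𝓡 n) x₀).source)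
    (v : EuclideanSpace ℝ (Fin n)) : DifferentiableFieldAt (coordField x₀ v) x :=
  (mdifferentiableAt_const_field v _).mpullback_vectorField
    (n := ∞) (contMDiffAt_extChartAt' (by simpa using hx)) (isInvertible_mfderiv_extChartAt hx)
    (by norm_cast)

/-- Pullback by the chart respects brackets, and constant fields on `ℝⁿ` commute. -/
theorem mlieBracket_coordField {x₀ x : M} (hx : x ∈ (extChartAt (𝓡 n) x₀).source)
    (v w : EuclideanSpace ℝ (Fin n)) :
    mlieBracket (𝓡 n) (coordField x₀ v) (coordField x₀ w) x = 0 := by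
  have : IsManifold (𝓡 n) (minSmoothness ℝ 2) M := by
    simp only [minSmoothness_of_isRCLikeNormedField]; infer_instance
  have : IsManifold (𝓡 n) (minSmoothness ℝ 3) M := by
    simp only [minSmoothness_of_isRCLikeNormedField]; infer_instance
  have h := mpullback_mlieBracket (n := ∞) (I := 𝓡 n) (f := extChartAt (𝓡 n) x₀)
    (mdifferentiableAt_const_field v (extChartAt (𝓡 n) x₀ x))
    (mdifferentiableAt_const_field w (extChartAt (𝓡 n) x₀ x))
    (contMDiffAt_extChartAt' (by simpa using hx)) (by simp only [minSmoothness_of_isRCLikeNormedField]; norm_cast)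
  refine h.symm.trans ?_
  have h0 : mlieBracket 𝓘(ℝ, EuclideanSpace ℝ (Fin n)) (fun _ ↦ v) (fun _ ↦ w)
      (extChartAt (𝓡 n) x₀ x) = (0 : EuclideanSpace ℝ (Fin n)) := by
    have h1 := mlieBracketWithin_eq_lieBracketWithin (𝕜 := ℝ)
      (V := fun _ : EuclideanSpace ℝ (Fin n) ↦ v) (W := fun _ ↦ w) (s := univ)
    refine (congrFun (mlieBracketWithin_univ.symm.trans h1) _).trans ?_
    simp [lieBracketWithin]
    rfl
  rw [mpullback_apply]
  exact (congrArg _ h0).trans (map_zero _)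

theorem mfderiv_extChartAt_coordField {x₀ x : M} (hx : x ∈ (extChartAt (𝓡 n) x₀).source)
    (v : EuclideanSpace ℝ (Fin n)) :
    mfderiv (𝓡 n) (𝓡 n) (extChartAt (𝓡 n) x₀) x (coordField x₀ v x) = v :=
  (isInvertible_mfderiv_extChartAt hx).self_apply_inverse _

theorem coordField_eq_mfderiv_symm {x₀ x : M} (hx : x ∈ (extChartAt (𝓡 n) x₀).source)
    (v : EuclideanSpace ℝ (Fin n)) :
    coordField x₀ v x =
      mfderiv (𝓡 n) (𝓡 n) (extChartAt (𝓡 n) x₀).symm (extChartAt (𝓡 n) x₀ x) v := by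
  have h := DFunLike.congr_fun
    (mfderivWithin_extChartAt_symm_comp_mfderiv_extChartAt' (I := 𝓡 n) hx) (coordField x₀ v x)
  have h2 := mfderiv_extChartAt_coordField hx v
  simp only [modelWithCornersSelf_coe, range_id, mfderivWithin_univ] at h
  change mfderiv (𝓡 n) (𝓡 n) (extChartAt (𝓡 n) x₀).symm (extChartAt (𝓡 n) x₀ x)
    (mfderiv (𝓡 n) (𝓡 n) (extChartAt (𝓡 n) x₀) x (coordField x₀ v x)) = coordField x₀ v x at h
  exact h.symm.trans (congrArg _ h2)

theorem DiffForm.inChart_extChartAt (α : DiffForm n 1 M) {x₀ x : M}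
    (hx : x ∈ (extChartAt (𝓡 n) x₀).source) (v : EuclideanSpace ℝ (Fin n)) :
    α.inChart x₀ (extChartAt (𝓡 n) x₀ x) ![v] = α x ![coordField x₀ v x] := by
  -- The base points are only propositionally equal, so the equality is transported with the vector
  -- `u` held fixed in the model space.
  have h : ∀ x', x' = x → ∀ u : EuclideanSpace ℝ (Fin n),
      α x' ![u] = α x ![u] := by rintro _ rfl u; rfl
  rw [coordField_eq_mfderiv_symm hx]
  refine Eq.trans ?_ (h _ ((extChartAt (𝓡 n) x₀).left_inv hx) _)
  refine congrArg (α ((extChartAt (𝓡 n) x₀).symm (extChartAt (𝓡 n) x₀ x))) ?_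
  ext i
  fin_cases i
  rfl

omit [IsManifold (𝓡 n) ∞ M] in
theorem DiffForm.IsSmooth.differentiableAt_inChart {k : ℕ} {α : DiffForm n k M} (hα : α.IsSmooth)
    {x₀ : M} {y : EuclideanSpace ℝ (Fin n)} (hy : y ∈ (extChartAt (𝓡 n) x₀).target) :
    DifferentiableAt ℝ (α.inChart x₀) y :=
  ((hα x₀).contDiffAt ((isOpen_extChartAt_target x₀).mem_nhds hy)).differentiableAt (by simp)

omit [IsManifold (𝓡 n) ∞ M] in
theorem DiffForm.IsSmooth.differentiableAt_inChart_apply {k : ℕ} {α : DiffForm n k M}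
    (hα : α.IsSmooth) {x₀ : M} {y : EuclideanSpace ℝ (Fin n)}
    (hy : y ∈ (extChartAt (𝓡 n) x₀).target) (v : Fin k → EuclideanSpace ℝ (Fin n)) :
    DifferentiableAt ℝ (fun y ↦ α.inChart x₀ y v) y :=
  (hα.differentiableAt_inChart hy).continuousAlternatingMap_apply_const v

theorem mvfderiv_comp_extChartAt {x₀ x : M} (hx : x ∈ (extChartAt (𝓡 n) x₀).source)
    {h : EuclideanSpace ℝ (Fin n) → ℝ} {h' : EuclideanSpace ℝ (Fin n) →L[ℝ] ℝ}
    (hh : HasFDerivAt h h' (extChartAt (𝓡 n) x₀ x)) (u : TangentSpace (𝓡 n) x) :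
    mvfderiv (𝓡 n) (fun p ↦ h (extChartAt (𝓡 n) x₀ p)) x u =
      h' (mfderiv (𝓡 n) (𝓡 n) (extChartAt (𝓡 n) x₀) x u) := by
  have hc : HasMFDerivAt (𝓡 n) 𝓘(ℝ, ℝ) (h ∘ extChartAt (𝓡 n) x₀) x _ :=
    hh.hasMFDerivAt.comp x (mdifferentiableAt_extChartAt (by simpa using hx)).hasMFDerivAt
  change NormedSpace.fromTangentSpace _ (mfderiv (𝓡 n) 𝓘(ℝ, ℝ) (h ∘ extChartAt (𝓡 n) x₀) x u) = _
  rw [hc.mfderiv]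
  rfl

theorem mvfderiv_apply_coordField {α : DiffForm n 1 M} (hα : α.IsSmooth) {x₀ x : M}
    (hx : x ∈ (extChartAt (𝓡 n) x₀).source) (v w : EuclideanSpace ℝ (Fin n)) :
    mvfderiv (𝓡 n) (fun p ↦ α p ![coordField x₀ w p]) x (coordField x₀ v x) =
      fderiv ℝ (fun y ↦ α.inChart x₀ y ![w]) (extChartAt (𝓡 n) x₀ x) v := by
  have he : (fun p ↦ α p ![coordField x₀ w p]) =ᶠ[𝓝 x]
      fun p ↦ α.inChart x₀ (extChartAt (𝓡 n) x₀ p) ![w] := by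
    filter_upwards [(isOpen_extChartAt_source x₀).mem_nhds hx] with p hp
    exact (α.inChart_extChartAt hp w).symm
  have h1 : mvfderiv (𝓡 n) (fun p ↦ α p ![coordField x₀ w p]) x (coordField x₀ v x) =
      mvfderiv (𝓡 n) (fun p ↦ α.inChart x₀ (extChartAt (𝓡 n) x₀ p) ![w]) x
        (coordField x₀ v x) := by
    have := he.mfderiv_eq (I := 𝓡 n) (I' := 𝓘(ℝ, ℝ))
    exact DFunLike.congr_fun this (coordField x₀ v x)
  rw [h1, mvfderiv_comp_extChartAt hx (hα.differentiableAt_inChart_apply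
    ((extChartAt (𝓡 n) x₀).map_source hx) ![w]).hasFDerivAt]
  exact congrArg _ (mfderiv_extChartAt_coordField hx v)

/-! ### Parallel 1-forms are closed -/

/-- A smooth 1-form which is parallel for a torsion-free connection is closed, in every chart. -/
theorem IsParallelOneForm.fderiv_inChart_symm {cov : Connection n M} {α : DiffForm n 1 M}
    (h : IsParallelOneForm cov α) (hα : α.IsSmooth) (hcov : cov.torsion = 0) {x₀ : M}
    {y : EuclideanSpace ℝ (Fin n)} (hy : y ∈ (extChartAt (𝓡 n) x₀).target)
    (v w : EuclideanSpace ℝ (Fin n)) :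
    fderiv ℝ (fun y ↦ α.inChart x₀ y ![w]) y v = fderiv ℝ (fun y ↦ α.inChart x₀ y ![v]) y w := by
  set x := (extChartAt (𝓡 n) x₀).symm y with hxy
  have hx : x ∈ (extChartAt (𝓡 n) x₀).source := (extChartAt (𝓡 n) x₀).map_target hy
  have hyx : extChartAt (𝓡 n) x₀ x = y := (extChartAt (𝓡 n) x₀).right_inv hy
  have hv := differentiableFieldAt_coordField hx v
  have hw := differentiableFieldAt_coordField hx w
  have h1 := h x (coordField x₀ v x) _ hw
  have h2 := h x (coordField x₀ w x) _ hv
  rw [mvfderiv_apply_coordField hα hx, hyx, sub_eq_zero] at h1 h2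
  -- Coordinate fields commute, so zero torsion makes their mutual covariant derivatives equal;
  -- these are the right-hand sides of `h1` and `h2`.
  have h3 := (CovariantDerivative.torsion_eq_zero_iff cov).1 hcov hv hw
  rw [mlieBracket_coordField hx, sub_eq_zero] at h3
  rw [h1, h2, h3]

theorem IsParallelOneForm.d_eq_zero {cov : Connection n M} {α : DiffForm n 1 M}
    (h : IsParallelOneForm cov α) (hα : α.IsSmooth) (hcov : cov.torsion = 0) : α.d = 0 := by
  funext x
  have hy := mem_extChartAt_target (I := 𝓡 n) x
  have hz : extDeriv (α.inChart x) (extChartAt (𝓡 n) x x) = 0 := by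
    ext v
    rw [extDeriv_apply (hα.differentiableAt_inChart hy), Fin.sum_univ_two]
    have e0 : Fin.removeNth 0 v = ![v 1] := by ext i; fin_cases i; rfl
    have e1 : Fin.removeNth 1 v = ![v 0] := by ext i; fin_cases i; rfl
    rw [e0, e1, h.fderiv_inChart_symm hα hcov hy]
    simp
  rw [DiffForm.d, hz]
  rfl

theorem IsSmoothField.differentiableFieldAt {X : (x : M) → TangentSpace (𝓡 n) x}
    (hX : IsSmoothField X) (x : M) : DifferentiableFieldAt X x :=
  (hX x).mdifferentiableAt (by simp)

/-! ### Duality and the Reeb field -/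

/-- If `∇` and `∇'` are dual and `∇E = 0`, then the 1-form `g(·, E)` is parallel for `∇'`. -/
theorem IsDual.isParallelOneForm {g : Metric n M} {cov cov' : Connection n M}
    (h : IsDual g cov cov') {E : (x : M) → TangentSpace (𝓡 n) x} (hE : IsSmoothField E)
    (hcov : IsParallelField cov E) {α : DiffForm n 1 M}
    (hα : ∀ (x : M) (v : TangentSpace (𝓡 n) x), α x ![v] = g.inner x v (E x)) :
    IsParallelOneForm cov' α := by
  intro x v Y hY
  have h1 := h x v E Y (hE.differentiableFieldAt x) hY
  rw [hcov x v, map_zero, zero_apply, zero_add] at h1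
  have h2 : (fun p ↦ α p ![Y p]) = fun p ↦ g.inner p (E p) (Y p) := by
    funext p
    rw [hα, g.symm]
  rw [h2, h1, hα, g.symm, sub_self]

theorem IsSmatShsPair.isParallelOneForm {Ω : DiffForm n 2 M} {α : DiffForm n 1 M}
    {E : (x : M) → TangentSpace (𝓡 n) x}
    {Θ : (x : M) → TangentSpace (𝓡 n) x →L[ℝ] TangentSpace (𝓡 n) x} {g : Metric n M}
    {cov cov' : Connection n M} (h : IsSmatShsPair Ω α E g cov cov')
    (hg : IsAlmostContactMetric Ω α E Θ g) : IsParallelOneForm cov' α :=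
  h.adapted.elim
    (fun h' ↦ h.smat.dualistic.dual.isParallelOneForm hg.reeb.smooth h'.1 hg.alpha_eq) And.left

/-! ### Contact forms are not closed -/

theorem wedge_zero_right {k l : ℕ} {V : Type*} [AddCommGroup V] [Module ℝ V]
    (a : V [⋀^Fin k]→ₗ[ℝ] ℝ) : wedge a (0 : V [⋀^Fin l]→ₗ[ℝ] ℝ) = 0 := by
  have h : a.domCoprod (0 : V [⋀^Fin l]→ₗ[ℝ] ℝ) = 0 := by
    rw [← AlternatingMap.domCoprod'_apply, TensorProduct.tmul_zero, map_zero]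
  rw [wedge, h]
  ext v
  simp

/-- The case `m = 0` must be excluded: the empty power is the constant 1. -/
theorem wedgePow_zero_form {V : Type*} [AddCommGroup V] [Module ℝ V] {m : ℕ} (hm : 1 ≤ m) :
    wedgePow (0 : V [⋀^Fin 2]→ₗ[ℝ] ℝ) m = 0 := by
  obtain ⟨m, rfl⟩ := Nat.exists_eq_add_of_le' hm
  exact wedge_zero_right _

theorem IsContactForm.d_ne_zero {d : ℕ} {M : Type*} [TopologicalSpace M]
    [ChartedSpace (EuclideanSpace ℝ (Fin (2 * d + 1))) M] [Nonempty M]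
    {α : DiffForm (2 * d + 1) 1 M} (hα : IsContactForm α) (hd : 1 ≤ d) : α.d ≠ 0 := by
  intro h
  obtain ⟨x⟩ := ‹Nonempty M›
  refine hα.volume_ne_zero x ?_
  have h0 : (α.d x).toAlternatingMap = 0 := by rw [h]; rfl
  rw [h0, wedgePow_zero_form hd, wedge_zero_right]

end ShsGeometry

/-! ### Gluing local functions over a finite fundamental group -/

section GluingPrimitives

open Topology Set

/-- The real line with the discrete topology. -/
def DiscreteReal : Type := ℝ

/-- The identity from `ℝ` to `DiscreteReal`. -/
def DiscreteReal.ofReal (t : ℝ) : DiscreteReal := t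

instance : AddCommGroup DiscreteReal := inferInstanceAs (AddCommGroup ℝ)

instance : TopologicalSpace DiscreteReal := ⊥

instance : DiscreteTopology DiscreteReal := ⟨rfl⟩

variable {X : Type*} [TopologicalSpace X]

/-- Real functions on open sets whose differences are locally constant define a bundle with
discrete fibre. In the trivialization over `U i`, the coordinate `t` stands for the germs of
`φ i + t`. -/
def germBundleCore (U : X → Set X) (hU : ∀ i, IsOpen (U i)) (hmem : ∀ i, i ∈ U i)
    (φ : X → X → ℝ)
    (hφ : ∀ i j, ∀ x ∈ U i ∩ U j, ∀ᶠ y in 𝓝 x, φ i y - φ j y = φ i x - φ j x) :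
    FiberBundleCore X X DiscreteReal where
  baseSet := U
  isOpen_baseSet := hU
  indexAt := id
  mem_baseSet_at := hmem
  -- The same germ is `φ i + t = φ j + (t + (φ i - φ j))`.
  coordChange i j x t := t + DiscreteReal.ofReal (φ i x - φ j x)
  coordChange_self i x _ v := by
    exact (by simp : ∀ a b : ℝ, a + (b - b) = a) v (φ i x)
  continuousOn_coordChange i j := by
    rintro ⟨x, t⟩ ⟨hx, -⟩
    refine ContinuousAt.continuousWithinAt ?_
    refine continuousAt_const.congr (f := fun _ ↦ t + DiscreteReal.ofReal (φ i x - φ j x)) ?_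
    have ht : ∀ᶠ s : DiscreteReal in 𝓝 t, s = t := by simp [nhds_discrete]
    rw [nhds_prod_eq]
    filter_upwards [(hφ i j x hx).prod_mk ht] with p hp
    rw [hp.1, hp.2]
  coordChange_comp i j k x _ v := by
    change (((show ℝ from v) + (φ i x - φ j x)) + (φ j x - φ k x) : ℝ) = (show ℝ from v) + (φ i x - φ k x)
    ring

/-- Monodromy sends the homotopy classes of paths from `p e` to `x` onto this set, and composing
with a fixed return path embeds those classes in the fundamental group. -/
theorem IsCoveringMap.finite_joined_fiber {E : Type*} [TopologicalSpace E] {p : E → X}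
    (hp : IsCoveringMap p) (e : E) [Finite (FundamentalGroup X (p e))] (x : X) :
    {e' : E | p e' = x ∧ Joined e e'}.Finite := by
  rcases isEmpty_or_nonempty (Path (p e) x) with h | ⟨⟨δ⟩⟩
  · convert Set.finite_empty
    ext e'
    simp only [mem_ofPred_eq, mem_empty_iff_false, iff_false, not_and]
    rintro rfl ⟨γ⟩
    exact h.elim (γ.map hp.continuous)
  have : Finite (Path.Homotopic.Quotient (p e) (p e)) := ‹Finite (FundamentalGroup X (p e))›
  have hfin : Finite (Path.Homotopic.Quotient (p e) x) := by
    refine Finite.of_injective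
      (fun γ ↦ Path.Homotopic.Quotient.trans γ (Path.Homotopic.Quotient.mk δ.symm))
      fun γ γ' h ↦ ?_
    have h' := congrArg
      (fun η ↦ Path.Homotopic.Quotient.trans η (Path.Homotopic.Quotient.mk δ)) h
    simpa [Path.Homotopic.Quotient.trans_assoc] using h'
  refine (Set.finite_range fun γ : Path.Homotopic.Quotient (p e) x ↦
    (hp.monodromy γ ⟨e, rfl⟩ : E)).subset ?_
  rintro e' ⟨rfl, ⟨γ⟩⟩
  exact ⟨Path.Homotopic.Quotient.map (.mk γ) ⟨p, hp.continuous⟩,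
    congrArg Subtype.val (hp.monodromy_map (.mk γ))⟩

theorem IsCoveringMap.exists_joined_fiber {E : Type*} [TopologicalSpace E] {p : E → X}
    (hp : IsCoveringMap p) [PathConnectedSpace X] (e : E) (x : X) :
    ∃ e' : E, p e' = x ∧ Joined e e' := by
  obtain ⟨γ⟩ := PathConnectedSpace.joined (p e) x
  let c := hp.monodromy (.mk γ) ⟨e, rfl⟩
  obtain ⟨δ, -⟩ := Quotient.exists_rep (hp.liftPathQuotient (.mk γ) ⟨e, rfl⟩)
  exact ⟨c, c.2, ⟨δ⟩⟩

/-- On a path connected space with finite fundamental group, local functions with locally constant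
differences are, up to constants, the restrictions of a global function. -/
theorem exists_global_of_locally_constant_differences [PathConnectedSpace X]
    [LocallyPathConnectedSpace X] (x₀ : X) [Finite (FundamentalGroup X x₀)]
    (U : X → Set X) (hU : ∀ i, IsOpen (U i)) (hmem : ∀ i, i ∈ U i) (φ : X → X → ℝ)
    (hφ : ∀ i j, ∀ x ∈ U i ∩ U j, ∀ᶠ y in 𝓝 x, φ i y - φ j y = φ i x - φ j x) :
    ∃ f : X → ℝ, ∀ x, ∀ᶠ y in 𝓝 x, f y - f x = φ x y - φ x x := by
  let Z := germBundleCore U hU hmem φ hφ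
  have hp : IsCoveringMap Z.proj := FiberBundle.isCoveringMap
  -- `pt x s` is the germ at `x` with value `s`, whence the shift by `φ x x`.
  let pt : X → ℝ → Z.TotalSpace := fun x s ↦ ⟨x, DiscreteReal.ofReal (s - φ x x)⟩
  let e₀ : Z.TotalSpace := pt x₀ 0
  have : Finite (FundamentalGroup X (Z.proj e₀)) := ‹Finite (FundamentalGroup X x₀)›
  let T : X → Set ℝ := fun x ↦ {s | Joined e₀ (pt x s)}
  have hpt : ∀ x, Function.Injective (pt x) := by
    intro x s s' h
    exact sub_left_injective (Bundle.TotalSpace.mk_inj.1 h)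
  have hfin : ∀ x, (T x).Finite := by
    intro x
    refine ((hp.finite_joined_fiber e₀ x).preimage (hpt x).injOn).subset ?_
    exact fun s hs ↦ ⟨rfl, hs⟩
  have hne : ∀ x, (T x).Nonempty := by
    intro x
    obtain ⟨⟨y, t⟩, hy, hj⟩ := hp.exists_joined_fiber e₀ x
    obtain rfl : y = x := hy
    refine ⟨(show ℝ from t) + φ y y, ?_⟩
    change Joined e₀ _
    convert hj using 1
    exact congrArg (Bundle.TotalSpace.mk' DiscreteReal y)
      ((by simp : ∀ a b : ℝ, a + b - b = a) t (φ y y))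
  -- A path inside `U x` lifts with constant coordinate in the trivialization over `U x`; along this
  -- sheet the value changes as `φ x` does.
  have hsheet : ∀ x y, JoinedIn (U x) x y → ∀ s, Joined (pt x s) (pt y (s + (φ x y - φ x x))) := by
    intro x y ⟨γ, hγ⟩ s
    let t : DiscreteReal := DiscreteReal.ofReal (s - φ x x)
    have hc : Continuous fun r ↦ (Z.localTriv x).toOpenPartialHomeomorph.symm (γ r, t) := by
      refine (Z.localTriv x).toOpenPartialHomeomorph.continuousOn_symm.comp_continuous
        (by fun_prop) fun r ↦ ?_
      rw [(Z.localTriv x).mem_target]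
      exact hγ r
    refine ⟨⟨⟨_, hc⟩, ?_, ?_⟩⟩
    · change (⟨γ 0, _⟩ : Z.TotalSpace) = ⟨x, _⟩
      rw [γ.source]
      congr 1
      change (s - φ x x) + (φ x x - φ x x) = s - φ x x
      ring
    · change (⟨γ 1, _⟩ : Z.TotalSpace) = ⟨y, _⟩
      rw [γ.target]
      congr 1
      change (s - φ x x) + (φ x y - φ y y) = s + (φ x y - φ x x) - φ y y
      ring
  -- Nearby sets `T x` and `T y` are translates by the increment of `φ x`, so their maxima differ by
  -- this increment.
  have hmax : ∀ x, ∃ s, IsGreatest (T x) s := fun x ↦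
    ⟨_, (hfin x).isCompact.isGreatest_sSup (hne x)⟩
  choose f hf using hmax
  refine ⟨f, fun x ↦ ?_⟩
  have hnhds : pathComponentIn (U x) x ∈ 𝓝 x :=
    pathComponentIn_mem_nhds ((hU x).mem_nhds (hmem x))
  filter_upwards [hnhds] with y hy
  have h1 : f x + (φ x y - φ x x) ∈ T y := (hf x).1.trans (hsheet x y hy (f x))
  have h2 : f y - (φ x y - φ x x) ∈ T x := by
    refine (hf y).1.trans ?_
    have := (hsheet x y hy (f y - (φ x y - φ x x))).symm
    simpa using this
  linarith [(hf y).2 h1, (hf x).2 h2]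

end GluingPrimitives

namespace ShsGeometry

open Topology Set

/-! ### Closed 1-forms on compact manifolds -/

section Primitives

variable {n : ℕ} {M : Type*} [TopologicalSpace M] [ChartedSpace (EuclideanSpace ℝ (Fin n)) M]
  [IsManifold (𝓡 n) ∞ M]

omit [IsManifold (𝓡 n) ∞ M] in
/-- A closed 1-form has a primitive on a ball around any point of a chart. -/
theorem DiffForm.exists_primitive_inChart {α : DiffForm n 1 M} (hα : α.IsSmooth) (x₀ : M)
    (hclosed : ∀ y ∈ (extChartAt (𝓡 n) x₀).target, ∀ v w,
      fderiv ℝ (fun y ↦ α.inChart x₀ y ![w]) y v = fderiv ℝ (fun y ↦ α.inChart x₀ y ![v]) y w) :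
    ∃ V : Set (EuclideanSpace ℝ (Fin n)), IsOpen V ∧ V ⊆ (extChartAt (𝓡 n) x₀).target ∧
      extChartAt (𝓡 n) x₀ x₀ ∈ V ∧
      ∃ (h : EuclideanSpace ℝ (Fin n) → ℝ)
        (h' : EuclideanSpace ℝ (Fin n) → EuclideanSpace ℝ (Fin n) →L[ℝ] ℝ),
        (∀ y v, h' y v = α.inChart x₀ y ![v]) ∧ ∀ y ∈ V, HasFDerivAt h (h' y) y := by
  obtain ⟨r, hr, hV⟩ := Metric.isOpen_iff.1 (isOpen_extChartAt_target (I := 𝓡 n) x₀) _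
    (mem_extChartAt_target x₀)
  let η : EuclideanSpace ℝ (Fin n) → EuclideanSpace ℝ (Fin n) →L[ℝ] ℝ := fun y ↦
    (ContinuousAlternatingMap.ofSubsingletonLIE (𝕜 := ℝ)
      (E := EuclideanSpace ℝ (Fin n)) (F := ℝ) (0 : Fin 1)).symm
      (α.inChart x₀ y)
  have hη : ∀ y v, η y v = α.inChart x₀ y ![v] := by
    intro y v
    change α.inChart x₀ y (fun _ ↦ v) = _
    congr 1
    ext i
    fin_cases i
    rfl
  have hd : DifferentiableOn ℝ η (Metric.ball (extChartAt (𝓡 n) x₀ x₀) r) := by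
    intro y hy
    exact ((LinearIsometryEquiv.differentiable _).differentiableAt.comp y
      (hα.differentiableAt_inChart (hV hy))).differentiableWithinAt
  obtain ⟨h, hh⟩ := (convex_ball _ r).exists_forall_hasFDerivAt_of_fderiv_symmetric
    -- The Poincaré lemma on a convex open set needs the derivative of `η` to be symmetric, which is
    -- closedness in coordinates.
    Metric.isOpen_ball hd fun y hy v w ↦ by
      have hdy := (hd y hy).differentiableAt (Metric.isOpen_ball.mem_nhds hy)
      have key : ∀ u z, fderiv ℝ η y u z = fderiv ℝ (fun y ↦ α.inChart x₀ y ![z]) y u := by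
        intro u z
        have e : (fun y ↦ α.inChart x₀ y ![z]) = fun y ↦ η y z := by
          funext y; exact (hη y z).symm
        rw [e, fderiv_clm_apply hdy (differentiableAt_const z)]
        simp
      rw [key, key, hclosed y (hV hy)]
  exact ⟨_, Metric.isOpen_ball, hV, Metric.mem_ball_self hr, h, η, hη, hh⟩

/-- Read in a chart, the function has zero derivative on a ball, which is connected. Applied to
differences of local primitives. -/
theorem eventually_eq_of_hasMFDerivAt_zero {f : M → ℝ} {x : M}
    (hf : ∀ᶠ p in 𝓝 x, HasMFDerivAt (𝓡 n) 𝓘(ℝ, ℝ) f p 0) : ∀ᶠ p in 𝓝 x, f p = f x := by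
  have hc : ContinuousAt (extChartAt (𝓡 n) x).symm (extChartAt (𝓡 n) x x) :=
    continuousAt_extChartAt_symm x
  have hev : ∀ᶠ y in 𝓝 (extChartAt (𝓡 n) x x), y ∈ (extChartAt (𝓡 n) x).target ∧
      HasMFDerivAt (𝓡 n) 𝓘(ℝ, ℝ) f ((extChartAt (𝓡 n) x).symm y) 0 := by
    refine Filter.Eventually.and
      ((isOpen_extChartAt_target x).mem_nhds (mem_extChartAt_target x)) (hc.eventually
        (p := fun p ↦ HasMFDerivAt (𝓡 n) 𝓘(ℝ, ℝ) f p 0) ?_)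
    rwa [extChartAt_to_inv]
  obtain ⟨r, hr, hB⟩ := Metric.eventually_nhds_iff_ball.1 hev
  have hder : ∀ y ∈ Metric.ball (extChartAt (𝓡 n) x x) r,
      HasFDerivAt (f ∘ (extChartAt (𝓡 n) x).symm) (0 : EuclideanSpace ℝ (Fin n) →L[ℝ] ℝ) y := by
    intro y hy
    have hs : MDifferentiableAt (𝓡 n) (𝓡 n) (extChartAt (𝓡 n) x).symm y :=
      ((contMDiffOn_extChartAt_symm (n := ∞) x).contMDiffAt
        ((isOpen_extChartAt_target x).mem_nhds (hB y hy).1)).mdifferentiableAt (by simp)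
    have h0 := (hB y hy).2.comp y hs.hasMFDerivAt
    exact hasMFDerivAt_iff_hasFDerivAt.1 (h0.congr_mfderiv (ContinuousLinearMap.zero_comp _))
  obtain ⟨a, ha⟩ := Metric.isOpen_ball.exists_is_const_of_fderiv_eq_zero
    (convex_ball _ r).isPreconnected
    (fun y hy ↦ (hder y hy).differentiableAt.differentiableWithinAt)
    (fun y hy ↦ (hder y hy).fderiv)
  filter_upwards [(isOpen_extChartAt_source (I := 𝓡 n) x).mem_nhds (mem_extChartAt_source x),
    (continuousAt_extChartAt (I := 𝓡 n) x).preimage_mem_nhds (Metric.ball_mem_nhds _ hr)]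
    with p hp hpr
  have h1 := ha _ hpr
  have h2 := ha _ (Metric.mem_ball_self hr)
  simp only [Function.comp_apply, (extChartAt (𝓡 n) x).left_inv hp, extChartAt_to_inv] at h1 h2
  rw [h1, h2]

/-- A smooth closed 1-form on a compact connected manifold with finite fundamental group
vanishes somewhere. -/
theorem DiffForm.exists_eq_zero_of_closed [CompactSpace M] [ConnectedSpace M] (x₀ : M)
    [Finite (FundamentalGroup M x₀)] {α : DiffForm n 1 M} (hα : α.IsSmooth)
    (hclosed : ∀ (x : M), ∀ y ∈ (extChartAt (𝓡 n) x).target, ∀ v w,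
      fderiv ℝ (fun y ↦ α.inChart x y ![w]) y v = fderiv ℝ (fun y ↦ α.inChart x y ![v]) y w) :
    ∃ x, α x = 0 := by
  have : LocallyPathConnectedSpace M :=
    ChartedSpace.locallyPathConnectedSpace (EuclideanSpace ℝ (Fin n)) M
  have : PathConnectedSpace M := PathConnectedSpace.of_locallyPathConnectedSpace
  choose V hVo hVt hVm h h' hh' hh using
    fun x ↦ DiffForm.exists_primitive_inChart hα x (hclosed x)
  let U : M → Set M := fun x ↦ (extChartAt (𝓡 n) x).source ∩ extChartAt (𝓡 n) x ⁻¹' V x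
  let φ : M → M → ℝ := fun x p ↦ h x (extChartAt (𝓡 n) x p)
  have hU : ∀ x, IsOpen (U x) := fun x ↦
    (continuousOn_extChartAt x).isOpen_inter_preimage (isOpen_extChartAt_source x) (hVo x)
  have hmem : ∀ x, x ∈ U x := fun x ↦ ⟨mem_extChartAt_source x, hVm x⟩
  have hder : ∀ x, ∀ p ∈ U x, MDifferentiableAt (𝓡 n) 𝓘(ℝ, ℝ) (φ x) p ∧
      ∀ u : TangentSpace (𝓡 n) p, mvfderiv (𝓡 n) (φ x) p u = α p ![u] := by
    rintro x p ⟨hp, hpV⟩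
    refine ⟨(hh x _ hpV).differentiableAt.mdifferentiableAt.comp p
      (mdifferentiableAt_extChartAt (by simpa using hp)), fun u ↦ ?_⟩
    rw [mvfderiv_comp_extChartAt hp (hh x _ hpV)]
    refine (hh' x _ _).trans ?_
    refine (α.inChart_extChartAt hp _).trans (congrArg (fun z ↦ α p ![z]) ?_)
    exact (isInvertible_mfderiv_extChartAt hp).inverse_apply_self u
  obtain ⟨f, hf⟩ := exists_global_of_locally_constant_differences x₀ U hU hmem φ (by
    intro i j x hx
    refine eventually_eq_of_hasMFDerivAt_zero (n := n) (f := fun p ↦ φ i p - φ j p) ?_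
    filter_upwards [((hU i).inter (hU j)).mem_nhds hx] with p hp
    refine ((hder i p hp.1).1.hasMFDerivAt.sub (hder j p hp.2).1.hasMFDerivAt).congr_mfderiv ?_
    ext u
    have := ((hder i p hp.1).2 u).trans ((hder j p hp.2).2 u).symm
    exact sub_eq_zero.2 this)
  have hcont : Continuous f := by
    refine continuous_iff_continuousAt.2 fun x ↦ ?_
    have hφ : ContinuousAt (fun p ↦ f x + (φ x p - φ x x)) x :=
      continuousAt_const.add ((hder x x (hmem x)).1.continuousAt.sub continuousAt_const)
    refine hφ.congr ?_
    filter_upwards [hf x] with p hp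
    linarith
  obtain ⟨x, -, hx⟩ := isCompact_univ.exists_isMaxOn (univ_nonempty (α := M)) hcont.continuousOn
  refine ⟨x, ?_⟩
  -- Near `x` the local primitive has the same increments as `f`, so it inherits the maximum, and
  -- its derivative there represents `α x`.
  have hmax : IsLocalMax (h x) (extChartAt (𝓡 n) x x) := by
    have hc : ContinuousAt (extChartAt (𝓡 n) x).symm (extChartAt (𝓡 n) x x) :=
      continuousAt_extChartAt_symm x
    have ht : Filter.Tendsto (extChartAt (𝓡 n) x).symm (𝓝 (extChartAt (𝓡 n) x x)) (𝓝 x) := by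
      simpa only [ContinuousAt, extChartAt_to_inv] using hc
    filter_upwards [ht.eventually (hf x), (hVo x).mem_nhds (hVm x)] with y hy hyV
    have hle : f ((extChartAt (𝓡 n) x).symm y) ≤ f x := hx (mem_univ _)
    simp only [φ, (extChartAt (𝓡 n) x).right_inv (hVt x hyV)] at hy
    linarith
  have hz := hmax.hasFDerivAt_eq_zero (hh x _ (hVm x))
  ext u
  have hu : u = ![u 0] := by ext i; fin_cases i; rfl
  rw [hu, ← (hder x x (hmem x)).2, mvfderiv_comp_extChartAt (mem_extChartAt_source x)
    (hh x _ (hVm x)), hz]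
  rfl

end Primitives

end ShsGeometry

/-! ### The two non-existence statements -/

theorem mainTheorem11 {d : ℕ} {M : Type*} [TopologicalSpace M] [T2Space M]
    [SecondCountableTopology M] [ChartedSpace (EuclideanSpace ℝ (Fin (2 * d + 1))) M]
    [IsManifold (𝓡 (2 * d + 1)) ∞ M] :
    -- contact manifolds, with `Ω = dα`
    (1 ≤ d → Nonempty M →
      ∀ α : ShsGeometry.DiffForm (2 * d + 1) 1 M, ShsGeometry.IsContactForm α →
      ∀ (E : (x : M) → TangentSpace (𝓡 (2 * d + 1)) x)
        (Θ : (x : M) → TangentSpace (𝓡 (2 * d + 1)) x →L[ℝ] TangentSpace (𝓡 (2 * d + 1)) x)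
        (g : ShsGeometry.Metric (2 * d + 1) M),
        ShsGeometry.IsAlmostContactMetric α.d α E Θ g →
        ∀ cov cov' : ShsGeometry.Connection (2 * d + 1) M,
          ShsGeometry.IsSmatShsPair α.d α E g cov cov' →
          ¬ ShsGeometry.IsStatistical g cov cov') ∧
    -- compact shs manifolds with finite fundamental group
    (CompactSpace M → ConnectedSpace M → ∀ x₀ : M, Finite (FundamentalGroup M x₀) →
      ∀ (Ω : ShsGeometry.DiffForm (2 * d + 1) 2 M) (α : ShsGeometry.DiffForm (2 * d + 1) 1 M),
      ShsGeometry.IsStableHamiltonian Ω α →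
      ∀ (E : (x : M) → TangentSpace (𝓡 (2 * d + 1)) x)
        (Θ : (x : M) → TangentSpace (𝓡 (2 * d + 1)) x →L[ℝ] TangentSpace (𝓡 (2 * d + 1)) x)
        (g : ShsGeometry.Metric (2 * d + 1) M),
        ShsGeometry.IsAlmostContactMetric Ω α E Θ g →
        ∀ cov cov' : ShsGeometry.Connection (2 * d + 1) M,
          ShsGeometry.IsSmatShsPair Ω α E g cov cov' →
          ¬ ShsGeometry.IsStatistical g cov cov') := by
  refine ⟨fun hd hM α hα E Θ g hg cov cov' hcov hstat ↦ ?_,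
    fun hcpt hconn x₀ hfin Ω α hα E Θ g hg cov cov' hcov hstat ↦ ?_⟩
  · exact hα.d_ne_zero hd ((hcov.isParallelOneForm hg).d_eq_zero hα.smooth hstat.torsion_eq_zero')
  · obtain ⟨x, hx⟩ := ShsGeometry.DiffForm.exists_eq_zero_of_closed x₀ hα.smooth
      fun x y hy v w ↦
        (hcov.isParallelOneForm hg).fderiv_inChart_symm hα.smooth hstat.torsion_eq_zero' hy v w
    have h1 := hg.reeb.apply_eq_one x
    rw [hx] at h1
    exact zero_ne_one h1
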